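/- Let $L,P,P'$ be finite-dimensional quantum systems with fixed orthonormal bases and with $d_L=\dim L\ge 1$. Let $U(d_L)$ act on $L$ by its defining representation $U_L^g=g$, and on $P$ and $P'$ by arbitrary (continuous) unitary representations $g\mapsto U_P^g$ and $g\mapsto U_{P'}^g$. Let $\mathcal E:L\to P$ (the encoder) and $\mathcal N:P\to P'$ (the noise) be quantum channels, i.e. completely positive trace-preserving maps, which are $U(d_L)$-covariant: for all $g\in U(d_L)$, $$\mathcal E(g\rho g^\dagger)=U_P^g\,\mathcal E(\rho)\,U_P^{g\dagger},\qquad \mathcal N(U_P^g\sigma U_P^{g\dagger})=U_{P'}^g\,\mathcal N(\sigma)\,U_{P'}^{g\dagger}.$$ For real $\varepsilon$, call $\mathcal E$ $\varepsilon$-correctable under $\mathcal N$ if there is a channel $\mathcal D:P'\to L$ such that $F(\mathcal D\circ\mathcal N\circ\mathcal E(\psi),\psi)\ge 1-\varepsilon$ for every pure state $\psi$ of $L$, where $F(\rho,\sigma)=\big(\operatorname{tr}\sqrt{\sqrt\rho\,\sigma\sqrt\rho}\big)^2$. Let $$J(\mathcal N\circ\mathcal E)=\frac1{d_L}\sum_{i,j}|i\rangle\langle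 j|\otimes(\mathcal N\circ\mathcal E)(|i\rangle\langle j|)$$ be the Choi state of $\mathcal N\circ\mathcal E$ on $L\otimes P'$, and for an operator $K$ on $L\otimes P'$ let $$H_{\min}(L|P')_K=-\log_2\inf\{\operatorname{tr}X : X\ge 0 \text{ on } P',\ \mathbb 1_L\otimes X-K\ge 0\}.$$ Then $\mathcal E$ is $\varepsilon$-correctable under $\mathcal N$ if and only if $$H_{\min}(L|P')_{J(\mathcal N\circ\mathcal E)}\le-\log_2\big[d_L(1-c\,\varepsilon)\big],\qquad c=\frac{d_L+1}{d_L},$$ where the right-hand side is read as $+\infty$ when $1-c\,\varepsilon\le 0$. -/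

import Mathlib

open scoped Kronecker Matrix ComplexOrder

/-! Finite-dimensional quantum systems: a finite type `A` labels a fixed orthonormal basis of the
Hilbert space `ℂ^A`, and the operators on that space are the matrices `Matrix A A ℂ`. -/

namespace CovariantCode

noncomputable section

/-- Quantum states: positive semidefinite operators of unit trace. -/
def IsState {A : Type*} [Fintype A] (ρ : Matrix A A ℂ) : Prop :=
  ρ.PosSemidef ∧ ρ.trace = 1

/-- Pure states: quantum states of rank one. -/
def IsPure {A : Type*} [Fintype A] (ψ : Matrix A A ℂ) : Prop :=
  IsState ψ ∧ ψ.rank = 1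

/-- The square root of a (positive semidefinite) operator, by functional calculus. -/
def opSqrt {A : Type*} [Fintype A] [DecidableEq A] (ρ : Matrix A A ℂ) : Matrix A A ℂ :=
  cfc Real.sqrt ρ

/-- The fidelity `F(ρ, σ) = (tr √(√ρ σ √ρ))²`. -/
def fidelity {A : Type*} [Fintype A] [DecidableEq A] (ρ σ : Matrix A A ℂ) : ℝ :=
  (opSqrt (opSqrt ρ * σ * opSqrt ρ)).trace.re ^ 2

/-- The map `id_R ⊗ Φ`: it applies `Φ` to each of the `A`-blocks of an operator on `R ⊗ A`. -/
def idTensor (R : Type*) {A B : Type*} (Φ : Matrix A A ℂ →ₗ[ℂ] Matrix B B ℂ)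
    (M : Matrix (R × A) (R × A) ℂ) : Matrix (R × B) (R × B) ℂ :=
  Matrix.of fun x y => Φ (Matrix.of fun a a' => M (x.1, a) (y.1, a')) x.2 y.2

/-- Quantum channels: completely positive and trace-preserving linear maps. -/
structure IsChannel {A B : Type*} [Fintype A] [Fintype B]
    (Φ : Matrix A A ℂ →ₗ[ℂ] Matrix B B ℂ) : Prop where
  completelyPositive : ∀ (k : ℕ) (M : Matrix (Fin k × A) (Fin k × A) ℂ),
    M.PosSemidef → (idTensor (Fin k) Φ M).PosSemidef
  tracePreserving : ∀ ρ : Matrix A A ℂ, (Φ ρ).trace = ρ.trace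

/-- The unitary channel `ρ ↦ U ρ U†`. -/
def unitaryChannel {A : Type*} [Fintype A] [DecidableEq A] (U : Matrix.unitaryGroup A ℂ) :
    Matrix A A ℂ →ₗ[ℂ] Matrix A A ℂ where
  toFun ρ := (U : Matrix A A ℂ) * ρ * (U : Matrix A A ℂ)ᴴ
  map_add' ρ σ := by rw [mul_add, add_mul]
  map_smul' c ρ := by simp

/-- Covariance of a map `Φ` with respect to (continuous) unitary representations `u` and `v` of
`G` on its input and output systems: `Φ(u_g ρ u_g†) = v_g Φ(ρ) v_g†` for all `g`. -/
def IsCovariant {G A B : Type*} [Group G] [TopologicalSpace G] [Fintype A] [DecidableEq A]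
    [Fintype B] [DecidableEq B] (u : G →ₜ* Matrix.unitaryGroup A ℂ)
    (v : G →ₜ* Matrix.unitaryGroup B ℂ) (Φ : Matrix A A ℂ →ₗ[ℂ] Matrix B B ℂ) : Prop :=
  ∀ g : G, Φ ∘ₗ unitaryChannel (u g) = unitaryChannel (v g) ∘ₗ Φ

/-- The encoder `E` is `ε`-correctable under the noise `N`: a single recovery channel `D` restores
every pure logical state with fidelity at least `1 - ε`. -/
def IsCorrectable {L P P' : Type*} [Fintype L] [DecidableEq L] [Fintype P']
    (E : Matrix L L ℂ →ₗ[ℂ] Matrix P P ℂ) (N : Matrix P P ℂ →ₗ[ℂ] Matrix P' P' ℂ)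
    (ε : ℝ) : Prop :=
  ∃ D : Matrix P' P' ℂ →ₗ[ℂ] Matrix L L ℂ, IsChannel D ∧
    ∀ ψ : Matrix L L ℂ, IsPure ψ → 1 - ε ≤ fidelity (D (N (E ψ))) ψ

/-- The Choi state `J(Φ) = d_L⁻¹ (id_L ⊗ Φ)(∑ᵢⱼ |ii⟩⟨jj|)`, an operator on `L ⊗ B`. -/
def choiState {L B : Type*} [Fintype L] [DecidableEq L]
    (Φ : Matrix L L ℂ →ₗ[ℂ] Matrix B B ℂ) : Matrix (L × B) (L × B) ℂ :=
  (Fintype.card L : ℂ)⁻¹ •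
    idTensor L Φ (∑ i : L, ∑ j : L, Matrix.single (i, i) (j, j) (1 : ℂ))

/-- The conditional min-entropy
`H_min(A|B)_K = -log₂ inf {tr X | X ≥ 0, 1_A ⊗ X_B - K_AB ≥ 0}`. -/
def condMinEntropy {A B : Type*} [DecidableEq A] [Fintype B]
    (K : Matrix (A × B) (A × B) ℂ) : ℝ :=
  -Real.logb 2 (sInf {t : ℝ | ∃ X : Matrix B B ℂ,
    X.PosSemidef ∧ ((1 : Matrix A A ℂ) ⊗ₖ X - K).PosSemidef ∧ t = X.trace.re})

/-- The logarithm to base two with values in the extended reals, equal to `-∞` at `x ≤ 0`. -/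
def extLog (x : ℝ) : EReal :=
  if 0 < x then ((Real.logb 2 x : ℝ) : EReal) else ⊥

end

end CovariantCode

namespace CovariantCode

open Matrix

/-! Write d = d_L and Φ = N ∘ E. Recovery channels D correspond to operators C ≥ 0 on L ⊗ P' with
tr_L C = 1, through tr(D(σ)X) = tr(C(Xᵀ ⊗ σ)). Fidelity with a pure state and tr(C J(Φ)) are then
both linear in C, and semidefinite duality identifies the infimum defining H_min with the maximum m
of tr(C J(Φ)) over such C (`exists_dual_feasible`, `IsChannel.exists_condMinEntropy_eq`).

Conjugation by ḡ ⊗ v_g preserves the recoveries and tr(C J(Φ)), and permutes the pure-state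
fidelities. A recovery can therefore be replaced by an invariant one (`exists_conj_invariant`),
whose fidelity is a constant a because U(d) acts transitively on pure states. The second moment of
pure states gives tr(C J(Φ)) + 1 = a(d + 1) for it (`bilin_sum_of_eq_on_pure`). Hence worst-case
fidelity 1 - ε is reachable exactly when m ≥ (1 - ε)(d + 1) - 1 = d(1 - cε). -/

theorem single_eq_vecMulVec {A : Type*} [DecidableEq A] (i : A) :
    (single i i 1 : Matrix A A ℂ) = vecMulVec (Pi.single i 1) (star (Pi.single i 1)) := by
  rw [Pi.star_single, star_one, ← single_eq_single_vecMulVec_single]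

/-! ### Fidelity with pure states and their unitary orbit -/

section PureStates

variable {A : Type*} [Fintype A] [DecidableEq A]

theorem opSqrt_mul_self_of_posSemidef {M : Matrix A A ℂ} (hM : M.PosSemidef) :
    opSqrt (M * M) = M := by
  have hs : IsSelfAdjoint M := hM.isHermitian
  have hn := (posSemidef_iff_isHermitian_and_spectrum_nonneg.1 hM).2
  unfold opSqrt
  rw [← pow_two, ← cfc_comp_pow Real.sqrt 2 M (by fun_prop) hs]
  conv_rhs => rw [← cfc_id ℝ M hs]
  refine cfc_congr fun x hx => ?_
  have hx' : x ∈ {a : ℝ | 0 ≤ a} := by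
    have := hn ((spectrum.algebraMap_mem_iff ℂ).2 hx)
    simpa using this
  exact Real.sqrt_sq hx'

theorem isHermitian_opSqrt (M : Matrix A A ℂ) : (opSqrt M).IsHermitian :=
  cfc_predicate (p := IsSelfAdjoint) Real.sqrt M

theorem opSqrt_mul_opSqrt {M : Matrix A A ℂ} (hM : M.PosSemidef) :
    opSqrt M * opSqrt M = M := by
  have hs : IsSelfAdjoint M := hM.isHermitian
  have hn := (posSemidef_iff_isHermitian_and_spectrum_nonneg.1 hM).2
  unfold opSqrt
  rw [← cfc_mul Real.sqrt Real.sqrt M]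
  conv_rhs => rw [← cfc_id ℝ M hs]
  refine cfc_congr fun x hx => ?_
  have hx' : x ∈ {a : ℝ | 0 ≤ a} := by
    have := hn ((spectrum.algebraMap_mem_iff ℂ).2 hx)
    simpa using this
  exact Real.mul_self_sqrt hx'

/-- With r = ‖v‖², the root of |v⟩⟨v| is r^(-1/2) |v⟩⟨v|, of trace r^(1/2); v = 0 is treated apart.
-/
theorem trace_opSqrt_vecMulVec (v : A → ℂ) :
    (opSqrt (vecMulVec v (star v))).trace.re ^ 2 = (vecMulVec v (star v)).trace.re := by
  set r : ℝ := (v ⬝ᵥ star v).re with hr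
  have hv : v ⬝ᵥ star v = (r : ℂ) := by
    apply Complex.ext
    · simp [hr]
    · have : 0 ≤ v ⬝ᵥ star v := dotProduct_self_star_nonneg v
      simpa using (Complex.nonneg_iff.1 this).2.symm
  have hr0 : 0 ≤ r := (Complex.nonneg_iff.1 (dotProduct_self_star_nonneg v)).1
  rcases hr0.eq_or_lt with h0 | h0
  · have : v = 0 := dotProduct_self_star_eq_zero.1 (by rw [hv, ← h0]; simp)
    subst this
    have h := opSqrt_mul_self_of_posSemidef (A := A) PosSemidef.zero
    simp only [mul_zero] at h
    simp [h]
  · have hsq : (Real.sqrt r : ℂ) * Real.sqrt r = r := by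
      rw [← Complex.ofReal_mul, Real.mul_self_sqrt hr0]
    have hne : (Real.sqrt r : ℂ) ≠ 0 := by
      simpa using (Real.sqrt_pos.2 h0).ne'
    have hP : (((Real.sqrt r : ℂ)⁻¹) • vecMulVec v (star v)).PosSemidef := by
      refine (posSemidef_vecMulVec_self_star v).smul ?_
      rw [← Complex.ofReal_inv]
      exact_mod_cast inv_nonneg.2 (Real.sqrt_nonneg r)
    have hmul : (((Real.sqrt r : ℂ)⁻¹) • vecMulVec v (star v)) *
        (((Real.sqrt r : ℂ)⁻¹) • vecMulVec v (star v)) = vecMulVec v (star v) := by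
      rw [smul_mul_smul_comm, vecMulVec_mul_vecMulVec, dotProduct_comm, hv, vecMulVec_smul, smul_smul]
      rw [← hsq, mul_mul_mul_comm, inv_mul_cancel₀ hne, mul_one, one_smul]
    have := opSqrt_mul_self_of_posSemidef hP
    rw [hmul] at this
    rw [this, trace_smul, trace_vecMulVec, hv]
    have h2 : (Real.sqrt r : ℂ)⁻¹ • (r : ℂ) = (Real.sqrt r : ℂ) := by
      rw [smul_eq_mul]; nth_rewrite 1 [← hsq]; field_simp
    rw [h2]
    simp [Real.sq_sqrt hr0]

/-- √ρ |v⟩⟨v| √ρ is again of the form |w⟩⟨w|, with w = √ρ v, so the outer root disappears and the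
fidelity becomes linear in ρ. -/
theorem fidelity_vecMulVec {ρ : Matrix A A ℂ} (hρ : ρ.PosSemidef) (v : A → ℂ) :
    fidelity ρ (vecMulVec v (star v)) = (ρ * vecMulVec v (star v)).trace.re := by
  have h : opSqrt ρ * vecMulVec v (star v) * opSqrt ρ =
      vecMulVec (opSqrt ρ *ᵥ v) (star (opSqrt ρ *ᵥ v)) := by
    rw [mul_vecMulVec, vecMulVec_mul, star_mulVec, (isHermitian_opSqrt ρ).eq]
  unfold fidelity
  rw [h, trace_opSqrt_vecMulVec, ← h, trace_mul_cycle, opSqrt_mul_opSqrt hρ]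

theorem isPure_vecMulVec {v : A → ℂ} (hv : v ⬝ᵥ star v = 1) :
    IsPure (vecMulVec v (star v)) := by
  refine ⟨⟨posSemidef_vecMulVec_self_star v, by rw [trace_vecMulVec, hv]⟩, ?_⟩
  refine le_antisymm (rank_vecMulVec_le _ _) ?_
  rw [Nat.one_le_iff_ne_zero]
  intro h
  rw [Matrix.rank, Submodule.finrank_eq_zero, LinearMap.range_eq_bot] at h
  replace h : vecMulVec v (star v) = 0 := by
    ext a b
    simpa using congrFun (LinearMap.congr_fun h (Pi.single b 1)) a
  have := congrArg trace h
  rw [trace_vecMulVec, hv] at this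
  simp at this

theorem unitary_conj_single (g : Matrix.unitaryGroup A ℂ) (i : A) :
    (g : Matrix A A ℂ) * single i i 1 * (g : Matrix A A ℂ)ᴴ =
      vecMulVec ((g : Matrix A A ℂ) *ᵥ Pi.single i 1)
        (star ((g : Matrix A A ℂ) *ᵥ Pi.single i 1)) := by
  rw [single_eq_vecMulVec, mul_vecMulVec, vecMulVec_mul, star_mulVec]

/-- Rank one leaves a single nonzero eigenvalue and the trace makes it 1; g is the eigenvector
unitary. -/
theorem IsPure.exists_unitary {ψ : Matrix A A ℂ} (hψ : IsPure ψ) :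
    ∃ (g : Matrix.unitaryGroup A ℂ) (i : A),
      ψ = (g : Matrix A A ℂ) * single i i 1 * (g : Matrix A A ℂ)ᴴ := by
  obtain ⟨⟨hpos, htr⟩, hrk⟩ := hψ
  have hH := hpos.isHermitian
  rw [hH.rank_eq_card_non_zero_eigs, Fintype.card_eq_one_iff] at hrk
  obtain ⟨⟨i, hi⟩, huniq⟩ := hrk
  have h0 : ∀ j, j ≠ i → hH.eigenvalues j = 0 := fun j hj => by
    by_contra h
    exact hj (congrArg Subtype.val (huniq ⟨j, h⟩))
  have h1 : (hH.eigenvalues i : ℂ) = 1 := by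
    rw [hH.trace_eq_sum_eigenvalues, Finset.sum_eq_single i] at htr
    · exact htr
    · intro j _ hj; simp [h0 j hj]
    · simp
  refine ⟨hH.eigenvectorUnitary, i, ?_⟩
  have hd : diagonal (RCLike.ofReal ∘ hH.eigenvalues) = (single i i 1 : Matrix A A ℂ) := by
    rw [← diagonal_single]
    congr 1
    ext j
    by_cases hj : j = i
    · subst hj; simpa using h1
    · simp [h0 j hj, hj]
  conv_lhs => rw [hH.spectral_theorem]
  rw [Unitary.conjStarAlgAut_apply, hd]
  rfl

theorem exists_unitary_single_conj (i j : A) : ∃ g : Matrix.unitaryGroup A ℂ,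
    (single i i 1 : Matrix A A ℂ) = (g : Matrix A A ℂ) * single j j 1 * (g : Matrix A A ℂ)ᴴ := by
  refine ⟨⟨swap ℂ i j, mem_unitaryGroup_iff.2 ?_⟩, ?_⟩
  · rw [star_eq_conjTranspose, conjTranspose_swap, swap_mul_self]
  · rw [unitary_conj_single, single_eq_vecMulVec]
    have : swap ℂ i j *ᵥ Pi.single j 1 = Pi.single i 1 := by
      ext a
      simp only [swap_mulVec, Function.comp, Pi.single_apply, Equiv.swap_apply_eq_iff,
        Equiv.swap_apply_right]
    rw [this]

theorem IsPure.conj {ψ : Matrix A A ℂ} (hψ : IsPure ψ) (g : Matrix.unitaryGroup A ℂ) :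
    IsPure ((g : Matrix A A ℂ) * ψ * (g : Matrix A A ℂ)ᴴ) := by
  obtain ⟨h, i, rfl⟩ := hψ.exists_unitary
  have hgh : (g : Matrix A A ℂ) * ((h : Matrix A A ℂ) * single i i 1 * (h : Matrix A A ℂ)ᴴ) *
      (g : Matrix A A ℂ)ᴴ = ((g * h : Matrix.unitaryGroup A ℂ) : Matrix A A ℂ) * single i i 1 *
      ((g * h : Matrix.unitaryGroup A ℂ) : Matrix A A ℂ)ᴴ := by
    rw [Submonoid.coe_mul, conjTranspose_mul]
    simp only [mul_assoc]
  rw [hgh, unitary_conj_single]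
  refine isPure_vecMulVec ?_
  rw [← trace_vecMulVec, ← unitary_conj_single, trace_mul_cycle,
    ← star_eq_conjTranspose, mem_unitaryGroup_iff'.1 (g * h).2, one_mul, trace_single_eq_same]

end PureStates

/-! ### Choi matrices and operators representing recoveries -/

/-- The unnormalised Choi matrix `∑ᵢⱼ |i⟩⟨j| ⊗ Φ(|i⟩⟨j|)`. -/
def choiMatrix {A B : Type*} [DecidableEq A] (Φ : Matrix A A ℂ →ₗ[ℂ] Matrix B B ℂ) :
    Matrix (A × B) (A × B) ℂ :=
  Matrix.of fun x y => Φ (single x.1 y.1 1) x.2 y.2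

theorem choiState_eq {L B : Type*} [Fintype L] [DecidableEq L]
    (Φ : Matrix L L ℂ →ₗ[ℂ] Matrix B B ℂ) :
    choiState Φ = (Fintype.card L : ℂ)⁻¹ • choiMatrix Φ := by
  unfold choiState
  congr 1
  ext ⟨k, b⟩ ⟨l, b'⟩
  simp only [idTensor, choiMatrix, of_apply]
  refine congrFun (congrFun (congrArg Φ ?_) b) b'
  ext a a'
  simp [Matrix.sum_apply, single_apply, Prod.ext_iff, ite_and]

theorem IsChannel.posSemidef_choiMatrix {A B : Type*} [Fintype A] [DecidableEq A] [Fintype B]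
    {Φ : Matrix A A ℂ →ₗ[ℂ] Matrix B B ℂ} (hΦ : IsChannel Φ) : (choiMatrix Φ).PosSemidef := by
  let e := Fintype.equivFin A
  -- The unnormalised maximally entangled vector, with the ancilla relabelled by `Fin` as complete
  -- positivity requires.
  let w : Fin (Fintype.card A) × A → ℂ := fun x => if e x.2 = x.1 then 1 else 0
  have h := (hΦ.completelyPositive _ _ (posSemidef_vecMulVec_self_star w)).submatrix
    (fun x : A × B => (e x.1, x.2))
  convert h using 1
  ext ⟨k, b⟩ ⟨l, b'⟩
  simp only [choiMatrix, idTensor, of_apply, submatrix_apply]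
  refine congrFun (congrFun (congrArg Φ ?_) b) b'
  ext a a'
  simp only [single_apply, of_apply, vecMulVec_apply, w, Pi.star_apply, EmbeddingLike.apply_eq_iff_eq]
  by_cases h1 : a = k <;> by_cases h2 : a' = l <;> simp [h1, h2, eq_comm]
  all_goals grind

theorem IsChannel.map_posSemidef {A B : Type*} [Fintype A] [Fintype B]
    {Φ : Matrix A A ℂ →ₗ[ℂ] Matrix B B ℂ} (hΦ : IsChannel Φ) {ρ : Matrix A A ℂ}
    (hρ : ρ.PosSemidef) : (Φ ρ).PosSemidef :=
  (hΦ.completelyPositive 1 (ρ.submatrix Prod.snd Prod.snd) (hρ.submatrix _)).submatrix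
    (fun b : B => ((0 : Fin 1), b))

theorem IsChannel.comp {A B C : Type*} [Fintype A] [Fintype B] [Fintype C]
    {Φ : Matrix A A ℂ →ₗ[ℂ] Matrix B B ℂ} {Ψ : Matrix B B ℂ →ₗ[ℂ] Matrix C C ℂ}
    (hΨ : IsChannel Ψ) (hΦ : IsChannel Φ) : IsChannel (Ψ ∘ₗ Φ) where
  completelyPositive k M hM :=
    hΨ.completelyPositive k _ (hΦ.completelyPositive k M hM)
  tracePreserving ρ := by
    rw [LinearMap.comp_apply, hΨ.tracePreserving, hΦ.tracePreserving]

/-- The partial trace over the first factor. -/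
def traceFst {A B : Type*} [Fintype A] (C : Matrix (A × B) (A × B) ℂ) : Matrix B B ℂ :=
  Matrix.of fun b b' => ∑ a, C (a, b) (a, b')

/-- The operators on `A ⊗ B` that represent channels from `B` to `A`. -/
structure IsRecovery {A B : Type*} [Fintype A] [DecidableEq B]
    (C : Matrix (A × B) (A × B) ℂ) : Prop where
  posSemidef : C.PosSemidef
  traceFst_eq : traceFst C = 1

/-- The map from operators on `B` to operators on `A` represented by `C`, determined by
`tr (D(σ) A) = tr (C (Aᵀ ⊗ σ))`. -/
def recoveryMap {A B : Type*} [Fintype B] (C : Matrix (A × B) (A × B) ℂ) :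
    Matrix B B ℂ →ₗ[ℂ] Matrix A A ℂ where
  toFun σ := Matrix.of fun k l => ∑ b, ∑ b', C (l, b') (k, b) * σ b b'
  map_add' σ τ := by
    ext k l
    simp [mul_add, Finset.sum_add_distrib]
  map_smul' c σ := by
    ext k l
    simp [Finset.mul_sum, mul_left_comm]

section

variable {A B : Type*} [Fintype A] [Fintype B]

theorem trace_recoveryMap_mul (C : Matrix (A × B) (A × B) ℂ) (σ : Matrix B B ℂ)
    (X : Matrix A A ℂ) : (recoveryMap C σ * X).trace = (C * (Xᵀ ⊗ₖ σ)).trace := by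
  simp only [trace, diag, mul_apply, recoveryMap, LinearMap.coe_mk, AddHom.coe_mk, of_apply,
    Fintype.sum_prod_type, kroneckerMap_apply, transpose_apply, Finset.sum_mul]
  calc _ = ∑ k, ∑ l, ∑ b', ∑ b, C (l, b') (k, b) * σ b b' * X l k :=
        Finset.sum_congr rfl fun _ _ => Finset.sum_congr rfl fun _ _ => Finset.sum_comm
    _ = ∑ l, ∑ k, ∑ b', ∑ b, C (l, b') (k, b) * σ b b' * X l k := Finset.sum_comm
    _ = ∑ l, ∑ b', ∑ k, ∑ b, C (l, b') (k, b) * σ b b' * X l k :=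
        Finset.sum_congr rfl fun _ _ => Finset.sum_comm
    _ = _ := by simp only [mul_assoc, mul_comm (σ _ _)]

theorem trace_one_kronecker_mul [DecidableEq A] (C : Matrix (A × B) (A × B) ℂ)
    (X : Matrix B B ℂ) : (((1 : Matrix A A ℂ) ⊗ₖ X) * C).trace = (X * traceFst C).trace := by
  simp only [trace, diag, mul_apply, Fintype.sum_prod_type, kroneckerMap_apply, one_apply,
    traceFst, of_apply, ite_mul, one_mul, zero_mul, Finset.mul_sum]
  calc _ = ∑ a, ∑ b, ∑ b', X b b' * C (a, b') (a, b) := by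
        refine Finset.sum_congr rfl fun a _ => Finset.sum_congr rfl fun b _ => ?_
        rw [Finset.sum_eq_single a] <;> simp +contextual [eq_comm]
    _ = ∑ b, ∑ a, ∑ b', X b b' * C (a, b') (a, b) := Finset.sum_comm
    _ = _ := Finset.sum_congr rfl fun _ _ => Finset.sum_comm

theorem trace_traceFst (C : Matrix (A × B) (A × B) ℂ) : (traceFst C).trace = C.trace := by
  simp only [trace, diag, traceFst, of_apply, Fintype.sum_prod_type]
  exact Finset.sum_comm

/-- The partial trace is adjoint to X ↦ 1 ⊗ X, so it suffices to pair with every X; unitarity of g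
then removes it from the first factor. -/
theorem traceFst_conj [DecidableEq A] [DecidableEq B] {g : Matrix A A ℂ} (hg : g * gᴴ = 1)
    (V : Matrix B B ℂ) (C : Matrix (A × B) (A × B) ℂ) :
    traceFst ((g ⊗ₖ V)ᴴ * C * (g ⊗ₖ V)) = Vᴴ * traceFst C * V := by
  refine ext_iff_trace_mul_left.2 fun X => ?_
  rw [← trace_one_kronecker_mul, conjTranspose_kronecker]
  have h : (1 : Matrix A A ℂ) ⊗ₖ (V * X * Vᴴ) =
      (g ⊗ₖ V) * ((1 : Matrix A A ℂ) ⊗ₖ X) * (gᴴ ⊗ₖ Vᴴ) := by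
    rw [← mul_kronecker_mul, ← mul_kronecker_mul, mul_one, hg]
  calc _ = (((1 : Matrix A A ℂ) ⊗ₖ (V * X * Vᴴ)) * C).trace := by
        rw [h]
        simp only [← mul_assoc]
        rw [trace_mul_comm]
        simp only [← mul_assoc]
    _ = _ := by
        rw [trace_one_kronecker_mul, ← mul_assoc, ← mul_assoc, trace_mul_comm]
        simp only [← mul_assoc]
        rw [trace_mul_comm]
        simp only [← mul_assoc]
        rw [trace_mul_comm]
        simp only [← mul_assoc]

theorem IsRecovery.conj [DecidableEq A] [DecidableEq B] {C : Matrix (A × B) (A × B) ℂ}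
    (hC : IsRecovery C) {g : Matrix A A ℂ} (hg : g * gᴴ = 1) {V : Matrix B B ℂ}
    (hV : Vᴴ * V = 1) : IsRecovery ((g ⊗ₖ V)ᴴ * C * (g ⊗ₖ V)) where
  posSemidef := hC.posSemidef.conjTranspose_mul_mul_same _
  traceFst_eq := by rw [traceFst_conj hg, hC.traceFst_eq, mul_one, hV]

theorem IsRecovery.isChannel [DecidableEq B] {C : Matrix (A × B) (A × B) ℂ}
    (hC : IsRecovery C) : IsChannel (recoveryMap C) where
  completelyPositive m M hM := by
    classical
    -- Each row of G, reshaped to an A × B matrix, is a Kraus operator of the recovery map.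
    obtain ⟨G, rfl⟩ : ∃ G : Matrix (A × B) (A × B) ℂ, C = Gᴴ * G := by
      open scoped MatrixOrder in
      exact CStarAlgebra.nonneg_iff_eq_star_mul_self.1 hC.posSemidef.nonneg
    have : idTensor (Fin m) (recoveryMap (Gᴴ * G)) M = ∑ z : A × B,
        ((1 : Matrix (Fin m) (Fin m) ℂ) ⊗ₖ Matrix.of fun k b => G z (k, b)) * M *
        ((1 : Matrix (Fin m) (Fin m) ℂ) ⊗ₖ Matrix.of fun k b => G z (k, b))ᴴ := by
      ext ⟨i, k⟩ ⟨j, l⟩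
      simp only [idTensor, recoveryMap, of_apply, LinearMap.coe_mk, AddHom.coe_mk, Matrix.sum_apply,
        mul_apply, conjTranspose_apply, kroneckerMap_apply, one_apply, Fintype.sum_prod_type,
        ite_mul, one_mul, zero_mul, Finset.sum_ite_irrel, Finset.sum_ite_eq, Finset.sum_const_zero,
        Finset.mem_univ, if_true, apply_ite (star : ℂ → ℂ), star_zero, mul_ite, mul_zero]
      have hz (z : A) (w b b' : B) : star (G (z, w) (l, b')) * G (z, w) (k, b) * M (i, b) (j, b') =
          G (z, w) (k, b) * M (i, b) (j, b') * star (G (z, w) (l, b')) := by ring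
      simp only [Finset.sum_mul, hz]
      calc _ = ∑ b : B, ∑ z : A, ∑ b' : B, ∑ w : B,
            G (z, w) (k, b) * M (i, b) (j, b') * star (G (z, w) (l, b')) :=
            Finset.sum_congr rfl fun _ _ => Finset.sum_comm
        _ = ∑ z : A, ∑ b : B, ∑ b' : B, ∑ w : B,
            G (z, w) (k, b) * M (i, b) (j, b') * star (G (z, w) (l, b')) := Finset.sum_comm
        _ = ∑ z : A, ∑ b : B, ∑ w : B, ∑ b' : B,
            G (z, w) (k, b) * M (i, b) (j, b') * star (G (z, w) (l, b')) :=
            Finset.sum_congr rfl fun _ _ => Finset.sum_congr rfl fun _ _ => Finset.sum_comm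
        _ = ∑ z : A, ∑ w : B, ∑ b : B, ∑ b' : B,
            G (z, w) (k, b) * M (i, b) (j, b') * star (G (z, w) (l, b')) :=
            Finset.sum_congr rfl fun _ _ => Finset.sum_comm
        _ = _ := Finset.sum_congr rfl fun _ _ => Finset.sum_congr rfl fun _ _ => Finset.sum_comm
    rw [this]
    exact posSemidef_sum _ fun z _ => hM.mul_mul_conjTranspose_same _
  tracePreserving ρ := by
    classical
    have h := trace_recoveryMap_mul C ρ 1
    rw [mul_one, transpose_one, trace_mul_comm, trace_one_kronecker_mul, hC.traceFst_eq,
      mul_one] at h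
    exact h

/-- C is the Choi matrix of D transposed and with its factors swapped. Transposition preserves
positivity, and trace preservation on matrix units is the partial trace condition. -/
theorem IsChannel.exists_isRecovery [DecidableEq B] {D : Matrix B B ℂ →ₗ[ℂ] Matrix A A ℂ}
    (hD : IsChannel D) : ∃ C : Matrix (A × B) (A × B) ℂ, IsRecovery C ∧ recoveryMap C = D := by
  refine ⟨(choiMatrix D)ᵀ.submatrix Prod.swap Prod.swap,
    ⟨hD.posSemidef_choiMatrix.transpose.submatrix _, ?_⟩, ?_⟩
  · ext b b'
    have := hD.tracePreserving (single b' b 1)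
    simp only [traceFst, of_apply, submatrix_apply, transpose_apply, choiMatrix,
      Prod.swap_prod_mk]
    refine this.trans ?_
    by_cases h : b = b'
    · subst h; simp
    · rw [one_apply_ne h, trace_single_eq_of_ne _ _ _ (Ne.symm h)]
  · refine LinearMap.ext fun σ => ?_
    conv_rhs => rw [matrix_eq_sum_single σ]
    ext k l
    simp only [map_sum, Matrix.sum_apply, recoveryMap, LinearMap.coe_mk, AddHom.coe_mk, of_apply]
    refine Finset.sum_congr rfl fun b _ => Finset.sum_congr rfl fun b' _ => ?_
    rw [← mul_one (σ b b'), ← smul_eq_mul (σ b b'), ← smul_single, map_smul]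
    simp [choiMatrix, mul_comm]

end

/-! ### Convexity, compactness and trace pairings of positive operators -/

theorem convex_posSemidef {n : Type*} : Convex ℝ {M : Matrix n n ℂ | M.PosSemidef} :=
  fun _ hM _ hN _ _ ha hb _ => (PosSemidef.smul hM ha).add (PosSemidef.smul hN hb)

theorem traceFst_add {A B : Type*} [Fintype A] (C C' : Matrix (A × B) (A × B) ℂ) :
    traceFst (C + C') = traceFst C + traceFst C' := by
  ext b b'
  simp [traceFst, Finset.sum_add_distrib]

theorem traceFst_smul {A B : Type*} [Fintype A] (a : ℝ) (C : Matrix (A × B) (A × B) ℂ) :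
    traceFst (a • C) = a • traceFst C := by
  ext b b'
  simp [traceFst, Finset.mul_sum]

/-- The completely depolarizing recovery: a feasible point used for nonemptiness and for strict
inequalities. -/
theorem isRecovery_inv_card_smul_one {A B : Type*} [Fintype A] [Nonempty A]
    [DecidableEq A] [DecidableEq B] :
    IsRecovery ((Fintype.card A : ℝ)⁻¹ • (1 : Matrix (A × B) (A × B) ℂ)) where
  posSemidef := PosSemidef.one.smul (by positivity)
  traceFst_eq := by
    have : (Fintype.card A : ℂ) ≠ 0 := by simp
    ext b b'
    by_cases h : b = b' <;> simp [traceFst, one_apply, h, this]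

theorem convex_isRecovery {A B : Type*} [Fintype A] [DecidableEq B] : Convex ℝ {C : Matrix (A × B) (A × B) ℂ | IsRecovery C} :=
  fun _ hM _ hN _ _ ha hb hab =>
    ⟨convex_posSemidef hM.posSemidef hN.posSemidef ha hb hab, by
      rw [traceFst_add, traceFst_smul, traceFst_smul, hM.traceFst_eq, hN.traceFst_eq, ← add_smul,
        hab, one_smul]⟩

section

variable {n : Type*} [Fintype n]

theorem isClosed_posSemidef : IsClosed {M : Matrix n n ℂ | M.PosSemidef} := by
  simp only [posSemidef_iff_dotProduct_mulVec, Set.ofPred_and, Set.ofPred_forall]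
  refine IsClosed.inter (isClosed_eq (by fun_prop) continuous_id) (isClosed_iInter fun x => ?_)
  simp only [Complex.nonneg_iff, Set.ofPred_and]
  exact (isClosed_le continuous_const (by fun_prop)).inter
    (isClosed_eq continuous_const (by fun_prop))

/-- The 2 × 2 principal minor on i, j gives |M i j|² ≤ M i i · M j j. This bounds the slices of
fixed trace. -/
theorem norm_apply_le_trace {M : Matrix n n ℂ} (hM : M.PosSemidef) (i j : n) :
    ‖M i j‖ ≤ M.trace.re := by
  have hd (k : n) : 0 ≤ (M k k).re ∧ (M k k : ℂ) = ((M k k).re : ℂ) := by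
    have := Complex.nonneg_iff.1 (hM.diag_nonneg (i := k))
    exact ⟨this.1, Complex.ext rfl (by simp [this.2.symm])⟩
  have hle (k : n) : (M k k).re ≤ M.trace.re := by
    rw [trace, Complex.re_sum]
    exact Finset.single_le_sum (f := fun k => (M k k).re) (fun k _ => (hd k).1) (Finset.mem_univ k)
  have hdet := (Complex.nonneg_iff.1 (hM.submatrix ![i, j]).det_nonneg).1
  rw [det_fin_two] at hdet
  simp only [submatrix_apply, cons_val_zero, cons_val_one] at hdet
  have hji : M j i = star (M i j) := (hM.isHermitian.apply j i).symm
  rw [hji, (hd i).2, (hd j).2, Complex.star_def, Complex.mul_conj, ← Complex.ofReal_mul,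
    ← Complex.ofReal_sub, Complex.ofReal_re, Complex.normSq_eq_norm_sq] at hdet
  have h1 := (hd i).1
  have h2 := (hd j).1
  have h3 := hle i
  have h4 := hle j
  nlinarith [norm_nonneg (M i j)]

theorem isCompact_posSemidef_trace_eq (t : ℂ) :
    IsCompact {M : Matrix n n ℂ | M.PosSemidef ∧ M.trace = t} := by
  have hK : IsCompact (Set.univ.pi fun _ : n => Set.univ.pi fun _ : n =>
      Metric.closedBall (0 : ℂ) t.re) :=
    isCompact_univ_pi fun _ => isCompact_univ_pi fun _ => isCompact_closedBall _ _
  refine IsCompact.of_isClosed_subset (X := n → n → ℂ) hK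
    (isClosed_posSemidef.inter (isClosed_eq (by fun_prop) continuous_const)) ?_
  rintro M ⟨hM, ht⟩ i - j -
  rw [mem_closedBall_zero_iff, ← ht]
  exact norm_apply_le_trace hM i j

theorem trace_mul_nonneg {M C : Matrix n n ℂ} (hM : M.PosSemidef) (hC : C.PosSemidef) :
    0 ≤ (C * M).trace := by
  classical
  obtain ⟨G, rfl⟩ : ∃ G : Matrix n n ℂ, C = Gᴴ * G := by
    open scoped MatrixOrder in
    exact CStarAlgebra.nonneg_iff_eq_star_mul_self.1 hC.nonneg
  rw [mul_assoc, trace_mul_comm]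
  exact (hM.mul_mul_conjTranspose_same G).trace_nonneg

/-- Multiples of |x⟩⟨x| rescaled to trace t already suffice as tests, so positivity can be checked
on a compact slice of the cone. -/
theorem posSemidef_of_trace_mul_nonneg {M : Matrix n n ℂ} (hM : M.IsHermitian) {t : ℝ}
    (ht : 0 < t) (h : ∀ C : Matrix n n ℂ, C.PosSemidef → C.trace = t → 0 ≤ (C * M).trace.re) :
    M.PosSemidef := by
  refine .of_dotProduct_mulVec_nonneg hM fun x => Complex.nonneg_iff.2
    ⟨?_, (hM.im_star_dotProduct_mulVec_self x).symm⟩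
  by_cases hx : x = 0
  · simp [hx]
  set r : ℝ := (x ⬝ᵥ star x).re with hr
  have hpos : 0 < x ⬝ᵥ star x := dotProduct_self_star_pos_iff.2 hx
  obtain ⟨hr0, him⟩ := Complex.pos_iff.1 hpos
  have hxr : x ⬝ᵥ star x = (r : ℂ) := Complex.ext rfl (by simp [him.symm])
  have h1 := h ((t / r : ℝ) • vecMulVec x (star x))
    ((posSemidef_vecMulVec_self_star x).smul (div_pos ht hr0).le)
    (by
      rw [trace_smul, trace_vecMulVec, hxr, Complex.real_smul, ← Complex.ofReal_mul,
        div_mul_cancel₀ _ hr0.ne'])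
  rw [smul_mul_assoc, trace_smul, vecMulVec_mul, trace_vecMulVec, dotProduct_comm,
    ← dotProduct_mulVec, Complex.smul_re, smul_eq_mul] at h1
  exact nonneg_of_mul_nonneg_right h1 (div_pos ht hr0)

theorem exists_trace_mul_eq (f : Matrix n n ℂ →ₗ[ℝ] ℝ) :
    ∃ X : Matrix n n ℂ, ∀ Y, f Y = (Y * X).trace.re := by
  classical
  -- For y = p + iq, the real part of y (f₁ - i f₂) is p f₁ + q f₂.
  refine ⟨Matrix.of fun b a => (f (single a b 1) : ℂ) - f (single a b Complex.I) * Complex.I,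
    fun Y => ?_⟩
  conv_lhs => rw [matrix_eq_sum_single Y]
  simp only [map_sum, trace, diag, mul_apply, Complex.re_sum, of_apply]
  refine Finset.sum_congr rfl fun a _ => Finset.sum_congr rfl fun b _ => ?_
  have : single a b (Y a b) = (Y a b).re • (single a b 1 : Matrix n n ℂ) +
      (Y a b).im • (single a b Complex.I : Matrix n n ℂ) := by
    rw [smul_single, smul_single, ← single_add]
    congr 1
    simp only [Complex.real_smul, mul_one]
    exact (Complex.re_add_im _).symm
  rw [this, map_add, map_smul, map_smul]
  simp

/-- Allows a representing operator to be replaced by its Hermitian part. -/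
theorem re_trace_mul_conjTranspose {Y : Matrix n n ℂ} (hY : Y.IsHermitian) (X : Matrix n n ℂ) :
    (Y * Xᴴ).trace.re = (Y * X).trace.re := by
  rw [trace_mul_comm, ← hY.eq, ← conjTranspose_mul, trace_conjTranspose, hY.eq]
  simp

/-- This replaces averaging over a group. Unitary conjugation preserves the Hilbert–Schmidt norm,
whose minimiser on a compact convex set is unique by the parallelogram law, hence fixed. -/
theorem exists_conj_invariant [DecidableEq n] {K : Set (Matrix n n ℂ)} (hK : IsCompact K)
    (hconv : Convex ℝ K) (hne : K.Nonempty) (𝒲 : Set (Matrix n n ℂ))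
    (hunit : ∀ W ∈ 𝒲, W * Wᴴ = 1) (hinv : ∀ W ∈ 𝒲, ∀ C ∈ K, Wᴴ * C * W ∈ K) :
    ∃ C ∈ K, ∀ W ∈ 𝒲, Wᴴ * C * W = C := by
  let q : Matrix n n ℂ → ℝ := fun C => (Cᴴ * C).trace.re
  have hq0 (C) : 0 ≤ q C := (Complex.nonneg_iff.1 (posSemidef_conjTranspose_mul_self C).trace_nonneg).1
  obtain ⟨C, hC, hmin⟩ := hK.exists_isMinOn hne (f := q) (by fun_prop)
  refine ⟨C, hC, fun W hW => ?_⟩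
  set C' := Wᴴ * C * W with hC'
  have hqC : q C' = q C := by
    simp only [q, hC', conjTranspose_mul, conjTranspose_conjTranspose]
    calc ((Wᴴ * (Cᴴ * W)) * (Wᴴ * C * W)).trace.re = (Wᴴ * (Cᴴ * (W * Wᴴ) * C * W)).trace.re := by
          simp only [mul_assoc]
      _ = _ := by rw [hunit W hW, mul_one, trace_mul_comm, mul_assoc, mul_assoc, hunit W hW, mul_one]
  have hmid := hmin (hconv (hinv W hW C hC) hC (by norm_num : (0 : ℝ) ≤ 1 / 2)
    (by norm_num : (0 : ℝ) ≤ 1 / 2) (by norm_num))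
  have hpar : 4 * q ((1 / 2 : ℝ) • C' + (1 / 2 : ℝ) • C) + q (C' - C) = 2 * q C' + 2 * q C := by
    simp only [q, conjTranspose_add, conjTranspose_sub, conjTranspose_smul, star_trivial, mul_add,
      add_mul, mul_sub, sub_mul, smul_mul_smul_comm, trace_add, trace_sub, trace_smul,
      Complex.add_re, Complex.sub_re, Complex.smul_re, smul_eq_mul]
    ring
  have h0 : q (C' - C) = 0 := by
    have h1 := hq0 (C' - C)
    have h2 : q C ≤ q ((1 / 2 : ℝ) • C' + (1 / 2 : ℝ) • C) := hmid
    linarith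
  have h1 : ((C' - C)ᴴ * (C' - C)).trace = 0 := Complex.ext h0
    (Complex.nonneg_iff.1 (posSemidef_conjTranspose_mul_self _).trace_nonneg).2.symm
  exact sub_eq_zero.1 (trace_conjTranspose_mul_self_eq_zero_iff.1 h1)

end

/-! ### Duality for the min-entropy program -/

section Duality

variable {A B : Type*} [Fintype A] [Fintype B] [DecidableEq B]

theorem isCompact_isRecovery : IsCompact {C : Matrix (A × B) (A × B) ℂ | IsRecovery C} := by
  refine (isCompact_posSemidef_trace_eq (Fintype.card B : ℂ)).of_isClosed_subset ?_ ?_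
  · have : {C : Matrix (A × B) (A × B) ℂ | IsRecovery C} =
        {C | C.PosSemidef} ∩ {C | traceFst C = 1} :=
      Set.ext fun C => ⟨fun h => ⟨h.1, h.2⟩, fun h => ⟨h.1, h.2⟩⟩
    rw [this]
    refine isClosed_posSemidef.inter (isClosed_eq ?_ continuous_const)
    unfold traceFst
    fun_prop
  · intro C hC
    refine ⟨hC.posSemidef, ?_⟩
    rw [← trace_traceFst, hC.traceFst_eq, trace_one]

variable [DecidableEq A]

theorem trace_mul_le_of_dual_feasible {J C : Matrix (A × B) (A × B) ℂ} {X : Matrix B B ℂ}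
    (hC : IsRecovery C) (hX : ((1 : Matrix A A ℂ) ⊗ₖ X - J).PosSemidef) :
    (C * J).trace.re ≤ X.trace.re := by
  have h := (Complex.nonneg_iff.1 (trace_mul_nonneg hX hC.posSemidef)).1
  rw [mul_sub, trace_sub, trace_mul_comm, trace_one_kronecker_mul, hC.traceFst_eq, mul_one,
    Complex.sub_re] at h
  linarith

/-- Strong duality by separation: (1, t) lies outside the compact convex image of a trace slice
under C ↦ (tr_A C, tr(C J)). The separating functional, rescaled, is the dual witness X. -/
theorem exists_dual_feasible [Nonempty A] [Nonempty B] {J : Matrix (A × B) (A × B) ℂ}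
    (hJ : J.PosSemidef) {t : ℝ} (ht : ∀ C, IsRecovery C → (C * J).trace.re < t) :
    ∃ X : Matrix B B ℂ, X.PosSemidef ∧ ((1 : Matrix A A ℂ) ⊗ₖ X - J).PosSemidef ∧
      X.trace.re < t := by
  have hn : (0 : ℝ) < Fintype.card B := by exact_mod_cast Fintype.card_pos
  -- This trace is forced by tr_A C = 1, and fixing it makes the cone compact.
  set K : Set (Matrix (A × B) (A × B) ℂ) := {C | C.PosSemidef ∧ C.trace = (Fintype.card B : ℂ)}
  let T : Matrix (A × B) (A × B) ℂ → (B → B → ℂ) × ℝ := fun C => (traceFst C, (C * J).trace.re)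
  have hTlin : IsLinearMap ℝ T :=
    ⟨fun C C' => Prod.ext (traceFst_add C C') (by simp [T, add_mul]),
      fun a C => Prod.ext (traceFst_smul a C) (by simp [T])⟩
  have hTcont : Continuous T := by
    have : Continuous fun C : Matrix (A × B) (A × B) ℂ => traceFst C := by
      unfold traceFst
      fun_prop
    exact Continuous.prodMk this (by fun_prop)
  have hKconv : Convex ℝ K := by
    refine fun C hC C' hC' a b ha hb hab => ⟨convex_posSemidef hC.1 hC'.1 ha hb hab, ?_⟩
    rw [trace_add, trace_smul, trace_smul, hC.2, hC'.2, ← add_smul, hab, one_smul]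
  have hconv : Convex ℝ (T '' K) := hKconv.is_linear_image hTlin
  have hclosed : IsClosed (T '' K) :=
    ((isCompact_posSemidef_trace_eq _).image hTcont).isClosed
  have hmem : (((1 : Matrix B B ℂ), t) : (B → B → ℂ) × ℝ) ∉ T '' K := by
    rintro ⟨C, hC, hCt⟩
    have := ht C ⟨hC.1, congrArg Prod.fst hCt⟩
    exact this.ne (congrArg Prod.snd hCt)
  obtain ⟨f, u, hfu, hf⟩ := geometric_hahn_banach_point_closed hconv hclosed hmem
  let g : Matrix B B ℂ →ₗ[ℝ] ℝ :=
    f.toLinearMap ∘ₗ LinearMap.inl ℝ (B → B → ℂ) ℝ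
  set s : ℝ := f (0, 1) with hs
  have hfg (Y : Matrix B B ℂ) (r : ℝ) : f (Y, r) = g Y + r * s := by
    have : @Prod.mk (B → B → ℂ) ℝ Y r = @Prod.mk (B → B → ℂ) ℝ Y 0 + r • (0, 1) := by
      refine Prod.ext (funext fun b => funext fun b' => ?_) (by simp)
      change Y b b' = Y b b' + r • (0 : ℂ)
      rw [smul_zero, add_zero]
    rw [this, map_add, map_smul]
    rfl
  obtain ⟨X₀, hX₀⟩ := exists_trace_mul_eq g
  -- Hermitian part of the representing operator; since traces on K equal |B|, the shift absorbs u
  -- and makes the separation homogeneous.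
  set X₁ : Matrix B B ℂ := (1 / 2 : ℝ) • (X₀ + X₀ᴴ) - (u / Fintype.card B : ℝ) • 1 with hX₁
  have hX₁H : X₁.IsHermitian := by
    unfold X₁ IsHermitian
    simp [add_comm]
  have hX₁tr {Y : Matrix B B ℂ} (hY : Y.IsHermitian) (hYt : Y.trace = (Fintype.card B : ℂ)) :
      (Y * X₁).trace.re = g Y - u := by
    rw [hX₁, mul_sub, trace_sub, mul_smul_comm, mul_smul_comm, mul_one, trace_smul, trace_smul,
      mul_add, trace_add, hYt, Complex.sub_re, Complex.smul_re, Complex.smul_re, Complex.add_re,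
      re_trace_mul_conjTranspose hY, hX₀]
    simp only [smul_eq_mul, Complex.natCast_re]
    field_simp
    ring
  have hX₁neg : X₁.trace.re + t * s < 0 := by
    have h1 := hX₁tr (isHermitian_one) (trace_one)
    rw [one_mul] at h1
    rw [hfg] at hfu
    linarith
  set M : Matrix (A × B) (A × B) ℂ := (1 : Matrix A A ℂ) ⊗ₖ X₁ + s • J with hM
  have hMH : M.IsHermitian := by
    have h1 : ((1 : Matrix A A ℂ) ⊗ₖ X₁).IsHermitian := by
      rw [IsHermitian, conjTranspose_kronecker, conjTranspose_one, hX₁H.eq]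
    have h2 : (s • J).IsHermitian := by
      rw [IsHermitian, conjTranspose_smul, hJ.isHermitian.eq, star_trivial]
    exact h1.add h2
  have hMtr (C : Matrix (A × B) (A × B) ℂ) :
      (C * M).trace.re = (traceFst C * X₁).trace.re + (C * J).trace.re * s := by
    rw [hM, mul_add, trace_add, trace_mul_comm C, trace_one_kronecker_mul, trace_mul_comm X₁,
      mul_smul_comm, trace_smul, Complex.add_re, Complex.smul_re, smul_eq_mul, mul_comm s]
  have hMpos (C : Matrix (A × B) (A × B) ℂ) (hC : C.PosSemidef)
      (hCt : C.trace = (Fintype.card B : ℂ)) : 0 < (C * M).trace.re := by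
    have h1 := hf (T C) ⟨C, ⟨hC, hCt⟩, rfl⟩
    have hH : (traceFst C).IsHermitian := by
      ext b b'
      simp only [traceFst, conjTranspose_apply, of_apply, star_sum]
      exact Finset.sum_congr rfl fun a _ => hC.isHermitian.apply _ _
    have h2 : f (T C) = g (traceFst C) + (C * J).trace.re * s := hfg _ _
    rw [hMtr, hX₁tr hH (by rw [trace_traceFst, hCt])]
    linarith
  have hMpsd : M.PosSemidef :=
    posSemidef_of_trace_mul_nonneg hMH hn fun C hC hCt => (hMpos C hC (by simpa using hCt)).le
  -- The depolarizing recovery has value r < t with tr X₁ + r s > 0, while tr X₁ + t s < 0.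
  have hs0 : s < 0 := by
    have hR := isRecovery_inv_card_smul_one (A := A) (B := B)
    have h1 := hMpos _ hR.posSemidef (by rw [← trace_traceFst, hR.traceFst_eq, trace_one])
    rw [hMtr, hR.traceFst_eq, one_mul] at h1
    have h2 := ht _ hR
    nlinarith
  have hinv : 0 < (-s)⁻¹ := inv_pos.2 (neg_pos.2 hs0)
  have hfeas : ((1 : Matrix A A ℂ) ⊗ₖ ((-s)⁻¹ • X₁) - J).PosSemidef := by
    have : (1 : Matrix A A ℂ) ⊗ₖ ((-s)⁻¹ • X₁) - J = (-s)⁻¹ • M := by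
      rw [hM, smul_add, smul_smul, kronecker_smul, inv_neg, neg_mul, inv_mul_cancel₀ hs0.ne,
        neg_one_smul, sub_eq_add_neg]
    rw [this]
    exact hMpsd.smul hinv.le
  refine ⟨(-s)⁻¹ • X₁, ?_, hfeas, ?_⟩
  -- X is a diagonal block of 1 ⊗ X ≥ J ≥ 0.
  · obtain ⟨a⟩ := ‹Nonempty A›
    have := (hfeas.add hJ).submatrix (fun b : B => (a, b))
    rw [sub_add_cancel] at this
    convert this using 1
    ext b b'
    simp
  · rw [trace_smul, Complex.smul_re, smul_eq_mul, inv_mul_lt_iff₀ (neg_pos.2 hs0)]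
    linarith

end Duality

/-! ### Bilinear forms constant on pure states -/

section

variable {A : Type*} [Fintype A] [DecidableEq A]

theorem isPure_single (i : A) : IsPure (single i i 1 : Matrix A A ℂ) := by
  rw [single_eq_vecMulVec]
  exact isPure_vecMulVec (by simp)

theorem isPure_superposition {i k : A} (hik : i ≠ k) {ω : ℂ} (hω : ω * star ω = 1) :
    IsPure ((1 / 2 : ℂ) • (single i i 1 + single k k 1 + ω • single k i 1 + star ω • single i k 1 :
      Matrix A A ℂ)) := by
  have hs : ((Real.sqrt 2 : ℂ)⁻¹ * (Real.sqrt 2 : ℂ)⁻¹) = 1 / 2 := by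
    rw [← mul_inv, ← Complex.ofReal_mul, Real.mul_self_sqrt (by norm_num)]
    norm_num
  set w : A → ℂ := Pi.single i 1 + ω • Pi.single k 1 with hw
  have hw' : star w = Pi.single i 1 + star ω • Pi.single k 1 := by
    rw [hw, star_add, star_smul, Pi.star_single, Pi.star_single, star_one]
  have hvv : vecMulVec ((Real.sqrt 2 : ℂ)⁻¹ • w) (star ((Real.sqrt 2 : ℂ)⁻¹ • w)) =
      (1 / 2 : ℂ) • (single i i 1 + single k k 1 + ω • single k i 1 + star ω • single i k 1 :
      Matrix A A ℂ) := by
    rw [star_smul, vecMulVec_smul, smul_vecMulVec, smul_smul]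
    have : star ((Real.sqrt 2 : ℂ)⁻¹) = (Real.sqrt 2 : ℂ)⁻¹ := by
      rw [star_inv₀, Complex.star_def, Complex.conj_ofReal]
    rw [this, hs, hw', hw]
    simp only [vecMulVec_add, add_vecMulVec, vecMulVec_smul, smul_vecMulVec,
      ← single_eq_single_vecMulVec_single, smul_add, smul_smul]
    rw [mul_comm (star ω), hω]
    simp only [mul_one]
    abel
  rw [← hvv]
  refine isPure_vecMulVec ?_
  rw [star_smul, smul_dotProduct, dotProduct_smul, smul_smul, hw', hw]
  have : star ((Real.sqrt 2 : ℂ)⁻¹) = (Real.sqrt 2 : ℂ)⁻¹ := by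
    rw [star_inv₀, Complex.star_def, Complex.conj_ofReal]
  rw [this, hs]
  simp only [add_dotProduct, dotProduct_add, smul_dotProduct, dotProduct_smul,
    single_one_dotProduct, Pi.single_eq_same, Pi.single_eq_of_ne hik, Pi.single_eq_of_ne hik.symm,
    smul_eq_mul, mul_zero, mul_one, add_zero, zero_add]
  rw [mul_comm (star ω), hω]
  norm_num

/-- Evaluate on (e_i + ω e_k)/√2 and average over ω = 1, -1, i, -i: only terms of zero net phase
survive. -/
theorem bilin_offDiag_of_eq_on_pure (β : Matrix A A ℂ →ₗ[ℂ] Matrix A A ℂ →ₗ[ℂ] ℂ) {a : ℂ}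
    (h : ∀ ψ, IsPure ψ → β ψ ψ = a) {i k : A} (hik : i ≠ k) :
    β (single i i 1) (single k k 1) + β (single k k 1) (single i i 1) +
      β (single k i 1) (single i k 1) + β (single i k 1) (single k i 1) = 2 * a := by
  have hi := h _ (isPure_single i)
  have hk := h _ (isPure_single k)
  have key (ω : ℂ) (hω : ω * star ω = 1) := h _ (isPure_superposition hik hω)
  simp only [map_add, map_smul, LinearMap.add_apply, LinearMap.smul_apply, smul_eq_mul] at key
  have h1 := key 1 (by simp)
  have h2 := key (-1) (by simp)
  have h3 := key Complex.I (by simp)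
  have h4 := key (-Complex.I) (by simp)
  simp only [star_one, star_neg, Complex.star_def, Complex.conj_I, neg_neg] at h1 h2 h3 h4
  have hI : Complex.I * Complex.I = -1 := Complex.I_mul_I
  linear_combination h1 + h2 + h3 + h4 - hi - hk +
    (1 / 2) * (-β (single k i 1) (single k i 1) - β (single i k 1) (single i k 1) +
      β (single k i 1) (single i k 1) + β (single i k 1) (single k i 1)) * hI

/-- An algebraic form of the second moment of pure states, proportional to identity plus swap: the
pair identities are summed over all i, k. -/
theorem bilin_sum_of_eq_on_pure (β : Matrix A A ℂ →ₗ[ℂ] Matrix A A ℂ →ₗ[ℂ] ℂ) {a : ℂ}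
    (h : ∀ ψ, IsPure ψ → β ψ ψ = a) :
    ∑ i, ∑ k, β (single k i 1) (single i k 1) + β 1 1 =
      a * Fintype.card A * (Fintype.card A + 1) := by
  -- On the diagonal all four terms equal a, hence the extra 2a.
  have hpair (i k : A) : β (single i i 1) (single k k 1) + β (single k k 1) (single i i 1) +
      β (single k i 1) (single i k 1) + β (single i k 1) (single k i 1) =
      2 * a + if i = k then 2 * a else 0 := by
    by_cases hik : i = k
    · subst hik
      rw [if_pos rfl, h _ (isPure_single i)]
      ring
    · rw [if_neg hik, add_zero, bilin_offDiag_of_eq_on_pure β h hik]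
  have hone : β 1 1 = ∑ i, ∑ k, β (single i i 1) (single k k 1) := by
    have h1 : (1 : Matrix A A ℂ) = ∑ i, single i i 1 := by
      ext i j
      simp only [Matrix.sum_apply, single_apply, one_apply, ite_and, Finset.sum_ite_eq',
        Finset.mem_univ, if_true]
    rw [h1]
    simp only [map_sum, LinearMap.sum_apply]
    exact Finset.sum_comm
  have hsum := Finset.sum_congr (rfl : (Finset.univ : Finset A) = Finset.univ)
    fun i _ => Finset.sum_congr (rfl : (Finset.univ : Finset A) = Finset.univ)
      fun k _ => hpair i k
  simp only [Finset.sum_add_distrib, Finset.sum_const, Finset.sum_ite_eq, Finset.mem_univ,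
    if_true, Finset.card_univ, nsmul_eq_mul] at hsum
  have hc1 : ∑ i, ∑ k, β (single k k 1) (single i i 1) = β 1 1 := by rw [hone, Finset.sum_comm]
  have hc2 : ∑ i, ∑ k, β (single i k 1) (single k i 1) =
      ∑ i, ∑ k, β (single k i 1) (single i k 1) := Finset.sum_comm
  rw [hc1, hc2, ← hone] at hsum
  linear_combination hsum / 2

end

/-! ### Covariance and twirling of recoveries -/

theorem choiMatrix_eq_sum {L B : Type*} [Fintype L] [DecidableEq L] (Φ : Matrix L L ℂ →ₗ[ℂ] Matrix B B ℂ) :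
    choiMatrix Φ = ∑ k, ∑ l, single k l 1 ⊗ₖ Φ (single k l 1) := by
  ext ⟨k, b⟩ ⟨l, b'⟩
  simp [choiMatrix, Matrix.sum_apply, single_apply, ite_and]

/-- The bilinear form `(X, ρ) ↦ tr (C (Xᵀ ⊗ Φ(ρ))) = tr (D(Φ(ρ)) X)`. -/
def recoveryForm {L B : Type*} [Fintype L] [Fintype B] (Φ : Matrix L L ℂ →ₗ[ℂ] Matrix B B ℂ) (C : Matrix (L × B) (L × B) ℂ) :
    Matrix L L ℂ →ₗ[ℂ] Matrix L L ℂ →ₗ[ℂ] ℂ :=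
  LinearMap.mk₂ ℂ (fun X ρ => (C * (Xᵀ ⊗ₖ Φ ρ)).trace)
    (fun X Y ρ => by rw [transpose_add, add_kronecker, mul_add, trace_add])
    (fun c X ρ => by rw [transpose_smul, smul_kronecker, mul_smul_comm, trace_smul])
    (fun X ρ σ => by rw [map_add, kronecker_add, mul_add, trace_add])
    (fun c X ρ => by rw [map_smul, kronecker_smul, mul_smul_comm, trace_smul])

theorem recoveryForm_apply {L B : Type*} [Fintype L] [Fintype B] (Φ : Matrix L L ℂ →ₗ[ℂ] Matrix B B ℂ) (C : Matrix (L × B) (L × B) ℂ)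
    (X ρ : Matrix L L ℂ) : recoveryForm Φ C X ρ = (C * (Xᵀ ⊗ₖ Φ ρ)).trace := rfl

section Covariant

variable {L B : Type*} [Fintype L] [DecidableEq L] [Fintype B]

theorem mul_single_mul_apply {L : Type*} [Fintype L] [DecidableEq L] (X Y : Matrix L L ℂ)
    (i j k l : L) :
    (X * (single i j 1 : Matrix L L ℂ) * Y) k l = X k i * Y j l := by
  rw [single_eq_single_vecMulVec_single, mul_vecMulVec, vecMulVec_mul, vecMulVec_apply]
  simp

theorem trace_mul_choiMatrix (Φ : Matrix L L ℂ →ₗ[ℂ] Matrix B B ℂ)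
    (C : Matrix (L × B) (L × B) ℂ) :
    (C * choiMatrix Φ).trace = ∑ k, ∑ l, recoveryForm Φ C (single l k 1) (single k l 1) := by
  simp only [choiMatrix_eq_sum, Finset.mul_sum, trace_sum, recoveryForm_apply, transpose_single]

variable [DecidableEq B]

/-- If a recovery achieves the same fidelity `a` on all pure states, then `a` and the entanglement
fidelity `F` satisfy `d F + 1 = a (d + 1)`. -/
theorem IsRecovery.trace_mul_choiState [Nonempty L] {Φ : Matrix L L ℂ →ₗ[ℂ] Matrix B B ℂ}
    (hΦ : IsChannel Φ) {C : Matrix (L × B) (L × B) ℂ} (hC : IsRecovery C) {a : ℂ}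
    (h : ∀ ψ, IsPure ψ → recoveryForm Φ C ψ ψ = a) :
    (C * choiState Φ).trace + 1 = a * (Fintype.card L + 1) := by
  have hd : (Fintype.card L : ℂ) ≠ 0 := by simp
  have h1 : recoveryForm Φ C 1 1 = Fintype.card L := by
    rw [recoveryForm_apply, transpose_one, trace_mul_comm, trace_one_kronecker_mul,
      hC.traceFst_eq, mul_one, hΦ.tracePreserving, trace_one]
  have h2 := bilin_sum_of_eq_on_pure _ h
  rw [← trace_mul_choiMatrix, h1] at h2
  rw [choiState_eq, mul_smul_comm, trace_smul, smul_eq_mul]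
  field_simp
  linear_combination h2

/-- Turns correctability into linear constraints on C. -/
theorem IsRecovery.fidelity_eq {C : Matrix (L × B) (L × B) ℂ} (hC : IsRecovery C)
    {Φ : Matrix L L ℂ →ₗ[ℂ] Matrix B B ℂ} (hΦ : IsChannel Φ) {ψ : Matrix L L ℂ}
    (hψ : IsPure ψ) : fidelity (recoveryMap C (Φ ψ)) ψ = (recoveryForm Φ C ψ ψ).re := by
  have hpos := hC.isChannel.map_posSemidef (hΦ.map_posSemidef hψ.1.1)
  rw [recoveryForm_apply, ← trace_recoveryMap_mul]
  obtain ⟨g, i, hg⟩ := hψ.exists_unitary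
  rw [unitary_conj_single] at hg
  conv_lhs => rw [hg]
  rw [← hg, hg, fidelity_vecMulVec (hg ▸ hpos)]

variable {Φ : Matrix L L ℂ →ₗ[ℂ] Matrix B B ℂ}
  {v : Matrix.unitaryGroup L ℂ →ₜ* Matrix.unitaryGroup B ℂ}

theorem IsCovariant.map_conj
    (hΦ : IsCovariant (ContinuousMonoidHom.id (Matrix.unitaryGroup L ℂ)) v Φ)
    (g : Matrix.unitaryGroup L ℂ) (ρ : Matrix L L ℂ) :
    Φ ((g : Matrix L L ℂ) * ρ * (g : Matrix L L ℂ)ᴴ) =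
      (v g : Matrix B B ℂ) * Φ ρ * (v g : Matrix B B ℂ)ᴴ :=
  LinearMap.congr_fun (hΦ g) ρ

/-- The unitary `ḡ ⊗ v_g` on `L ⊗ B`. -/
noncomputable def twirlUnitary (v : Matrix.unitaryGroup L ℂ →ₜ* Matrix.unitaryGroup B ℂ)
    (g : Matrix.unitaryGroup L ℂ) : Matrix (L × B) (L × B) ℂ :=
  (g : Matrix L L ℂ)ᴴᵀ ⊗ₖ (v g : Matrix B B ℂ)

theorem unitaryGroup_mul_conjTranspose {n : Type*} [Fintype n] [DecidableEq n]
    (g : Matrix.unitaryGroup n ℂ) : (g : Matrix n n ℂ) * (g : Matrix n n ℂ)ᴴ = 1 :=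
  mem_unitaryGroup_iff.1 g.2

theorem unitaryGroup_conjTranspose_mul {n : Type*} [Fintype n] [DecidableEq n]
    (g : Matrix.unitaryGroup n ℂ) : (g : Matrix n n ℂ)ᴴ * (g : Matrix n n ℂ) = 1 :=
  mem_unitaryGroup_iff'.1 g.2

theorem conjTranspose_transpose_conjTranspose {n : Type*} (M : Matrix n n ℂ) :
    Mᴴᵀᴴ = Mᵀ := by
  ext i j
  simp

theorem conj_unitary_mul_conjTranspose (g : Matrix.unitaryGroup L ℂ) :
    (g : Matrix L L ℂ)ᴴᵀ * ((g : Matrix L L ℂ)ᴴᵀ)ᴴ = 1 := by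
  rw [conjTranspose_transpose_conjTranspose, ← transpose_mul, unitaryGroup_mul_conjTranspose, transpose_one]

theorem twirlUnitary_mul_conjTranspose (g : Matrix.unitaryGroup L ℂ) :
    twirlUnitary v g * (twirlUnitary v g)ᴴ = 1 := by
  rw [twirlUnitary, conjTranspose_kronecker, ← mul_kronecker_mul, conj_unitary_mul_conjTranspose,
    unitaryGroup_mul_conjTranspose, one_kronecker_one]

/-- The conjugate ḡ on the first factor matches the transpose: ḡ Xᵀ gᵀ = (g X g†)ᵀ. -/
theorem twirlUnitary_conj_kronecker (g : Matrix.unitaryGroup L ℂ) (X : Matrix L L ℂ)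
    (σ : Matrix B B ℂ) :
    twirlUnitary v g * (Xᵀ ⊗ₖ σ) * (twirlUnitary v g)ᴴ =
      ((g : Matrix L L ℂ) * X * (g : Matrix L L ℂ)ᴴ)ᵀ ⊗ₖ
        ((v g : Matrix B B ℂ) * σ * (v g : Matrix B B ℂ)ᴴ) := by
  rw [twirlUnitary, conjTranspose_kronecker, ← mul_kronecker_mul, ← mul_kronecker_mul,
    transpose_mul, transpose_mul, mul_assoc, conjTranspose_transpose_conjTranspose]

theorem trace_conj_mul {n : Type*} [Fintype n] (W C Z : Matrix n n ℂ) :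
    (Wᴴ * C * W * Z).trace = (C * (W * Z * Wᴴ)).trace := by
  rw [mul_assoc, mul_assoc, trace_mul_comm]
  simp only [mul_assoc]

theorem IsCovariant.recoveryForm_conj
    (hΦ : IsCovariant (ContinuousMonoidHom.id (Matrix.unitaryGroup L ℂ)) v Φ)
    (g : Matrix.unitaryGroup L ℂ) (C : Matrix (L × B) (L × B) ℂ) (X ρ : Matrix L L ℂ) :
    recoveryForm Φ ((twirlUnitary v g)ᴴ * C * twirlUnitary v g) X ρ =
      recoveryForm Φ C ((g : Matrix L L ℂ) * X * (g : Matrix L L ℂ)ᴴ)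
        ((g : Matrix L L ℂ) * ρ * (g : Matrix L L ℂ)ᴴ) := by
  rw [recoveryForm_apply, recoveryForm_apply, trace_conj_mul, twirlUnitary_conj_kronecker,
    hΦ.map_conj]

/-- The maximally entangled vector is fixed by ḡ ⊗ g, and covariance carries this through Φ. -/
theorem IsCovariant.twirlUnitary_conj_choiMatrix
    (hΦ : IsCovariant (ContinuousMonoidHom.id (Matrix.unitaryGroup L ℂ)) v Φ)
    (g : Matrix.unitaryGroup L ℂ) :
    twirlUnitary v g * choiMatrix Φ * (twirlUnitary v g)ᴴ = choiMatrix Φ := by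
  have h1 : twirlUnitary v g * choiMatrix Φ * (twirlUnitary v g)ᴴ = ∑ k, ∑ l,
      ((g : Matrix L L ℂ) * single l k 1 * (g : Matrix L L ℂ)ᴴ)ᵀ ⊗ₖ
        ((v g : Matrix B B ℂ) * Φ (single k l 1) * (v g : Matrix B B ℂ)ᴴ) := by
    simp only [← twirlUnitary_conj_kronecker, transpose_single, ← Finset.sum_mul,
      ← Finset.mul_sum, ← choiMatrix_eq_sum]
  rw [h1]
  ext ⟨k, b⟩ ⟨l, b'⟩
  -- Expressing the matrix unit as g (·) g† makes covariance applicable.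
  have h2 : (single k l 1 : Matrix L L ℂ) = (g : Matrix L L ℂ) *
      (∑ k', ∑ l', (star ((g : Matrix L L ℂ) k k') * (g : Matrix L L ℂ) l l') •
        single k' l' 1) * (g : Matrix L L ℂ)ᴴ := by
    have h3 : (g : Matrix L L ℂ)ᴴ * (single k l 1 : Matrix L L ℂ) * (g : Matrix L L ℂ) =
        ∑ k', ∑ l', (star ((g : Matrix L L ℂ) k k') * (g : Matrix L L ℂ) l l') •
          single k' l' 1 := by
      conv_lhs => rw [matrix_eq_sum_single ((g : Matrix L L ℂ)ᴴ * (single k l 1 : Matrix L L ℂ) * (g : Matrix L L ℂ))]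
      simp only [mul_single_mul_apply, conjTranspose_apply, smul_single, smul_eq_mul, mul_one]
    rw [← h3]
    simp only [mul_assoc, unitaryGroup_mul_conjTranspose, mul_one]
    rw [← mul_assoc, unitaryGroup_mul_conjTranspose, one_mul]
  simp only [choiMatrix, of_apply]
  rw [h2, hΦ.map_conj]
  simp only [map_sum, map_smul, Finset.mul_sum, Finset.sum_mul, mul_smul_comm, smul_mul_assoc,
    Matrix.sum_apply, Matrix.smul_apply, kroneckerMap_apply, transpose_apply,
    mul_single_mul_apply, conjTranspose_apply, smul_eq_mul]
  refine Finset.sum_congr rfl fun k' _ => Finset.sum_congr rfl fun l' _ => ?_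
  ring

theorem IsCovariant.trace_conj_mul_choiState
    (hΦ : IsCovariant (ContinuousMonoidHom.id (Matrix.unitaryGroup L ℂ)) v Φ)
    (g : Matrix.unitaryGroup L ℂ) (C : Matrix (L × B) (L × B) ℂ) :
    ((twirlUnitary v g)ᴴ * C * twirlUnitary v g * choiState Φ).trace =
      (C * choiState Φ).trace := by
  rw [trace_conj_mul, choiState_eq, mul_smul_comm, smul_mul_assoc,
    hΦ.twirlUnitary_conj_choiMatrix]

/-- Twirling: a closed convex invariant set that contains a recovery contains one with the same
fidelity on all pure states. -/
theorem IsCovariant.exists_isRecovery_const [Nonempty L] (hch : IsChannel Φ)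
    (hΦ : IsCovariant (ContinuousMonoidHom.id (Matrix.unitaryGroup L ℂ)) v Φ)
    {K : Set (Matrix (L × B) (L × B) ℂ)} (hclosed : IsClosed K) (hconv : Convex ℝ K)
    (hinv : ∀ g, ∀ C ∈ K, (twirlUnitary v g)ᴴ * C * twirlUnitary v g ∈ K)
    (hne : ∃ C ∈ K, IsRecovery C) :
    ∃ C ∈ K, IsRecovery C ∧ ∃ a : ℝ, (∀ ψ, IsPure ψ → (recoveryForm Φ C ψ ψ).re = a) ∧
      (C * choiState Φ).trace.re + 1 = a * (Fintype.card L + 1) := by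
  obtain ⟨C₀, hC₀K, hC₀⟩ := hne
  obtain ⟨C, ⟨hC, hCK⟩, hfix⟩ := exists_conj_invariant
    (isCompact_isRecovery.inter_right hclosed) (convex_isRecovery.inter hconv) ⟨C₀, hC₀, hC₀K⟩
    (Set.range (twirlUnitary v)) (by rintro _ ⟨g, rfl⟩; exact twirlUnitary_mul_conjTranspose g)
    (by
      rintro _ ⟨g, rfl⟩ C ⟨hC, hCK⟩
      exact ⟨hC.conj (conj_unitary_mul_conjTranspose g) (unitaryGroup_conjTranspose_mul (v g)),
        hinv g C hCK⟩)
  have hconj (g : Matrix.unitaryGroup L ℂ) (X : Matrix L L ℂ) :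
      recoveryForm Φ C ((g : Matrix L L ℂ) * X * (g : Matrix L L ℂ)ᴴ)
        ((g : Matrix L L ℂ) * X * (g : Matrix L L ℂ)ᴴ) = recoveryForm Φ C X X := by
    rw [← hΦ.recoveryForm_conj, hfix _ ⟨g, rfl⟩]
  obtain ⟨j⟩ := ‹Nonempty L›
  -- Pure states form a single unitary orbit, and the form is constant on orbits.
  have hconst (ψ : Matrix L L ℂ) (hψ : IsPure ψ) :
      recoveryForm Φ C ψ ψ = recoveryForm Φ C (single j j 1) (single j j 1) := by
    obtain ⟨g, i, rfl⟩ := hψ.exists_unitary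
    obtain ⟨g', hg'⟩ := exists_unitary_single_conj i j
    rw [hconj, hg', hconj]
  have : Nonempty L := ⟨j⟩
  refine ⟨C, hCK, hC, _, fun ψ hψ => congrArg Complex.re (hconst ψ hψ), ?_⟩
  have := congrArg Complex.re (hC.trace_mul_choiState hch hconst)
  simpa using this

/-- Either condition on C is closed, convex and invariant under the twirl, so it survives passage to
an invariant recovery, where tr(C J) + 1 = a(d + 1) converts it into the other. -/
theorem exists_isRecovery_iff [Nonempty L] (hch : IsChannel Φ)
    (hΦ : IsCovariant (ContinuousMonoidHom.id (Matrix.unitaryGroup L ℂ)) v Φ) (ε : ℝ) :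
    (∃ C, IsRecovery C ∧ ∀ ψ, IsPure ψ → 1 - ε ≤ (recoveryForm Φ C ψ ψ).re) ↔
      ∃ C, IsRecovery C ∧
        (1 - ε) * (Fintype.card L + 1) ≤ (C * choiState Φ).trace.re + 1 := by
  have hd : (0 : ℝ) < Fintype.card L + 1 := by positivity
  have hlin (X ρ : Matrix L L ℂ) : IsLinearMap ℝ fun C => (recoveryForm Φ C X ρ).re :=
    ⟨fun C C' => by simp [recoveryForm_apply, add_mul],
      fun a C => by simp [recoveryForm_apply]⟩
  have hlinJ : IsLinearMap ℝ fun C : Matrix (L × B) (L × B) ℂ => (C * choiState Φ).trace.re :=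
    ⟨fun C C' => by simp [add_mul], fun a C => by simp⟩
  constructor
  · rintro ⟨C₀, hC₀, h₀⟩
    -- Invariant because conjugation by g permutes the pure states.
    let K : Set (Matrix (L × B) (L × B) ℂ) :=
      ⋂ ψ : {ψ : Matrix L L ℂ // IsPure ψ}, {C | 1 - ε ≤ (recoveryForm Φ C ψ ψ).re}
    obtain ⟨C, hCK, hC, a, ha, hCa⟩ := hΦ.exists_isRecovery_const (K := K) hch
      (isClosed_iInter fun ψ => isClosed_le continuous_const
        (by simp only [recoveryForm_apply]; fun_prop))
      (convex_iInter fun ψ => convex_halfSpace_ge (hlin _ _) _)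
      (by
        intro g C hC
        refine Set.mem_iInter.2 fun ψ => ?_
        rw [Set.mem_ofPred_eq, hΦ.recoveryForm_conj]
        exact Set.mem_iInter.1 hC ⟨_, ψ.2.conj g⟩)
      ⟨C₀, Set.mem_iInter.2 fun ψ => h₀ ψ ψ.2, hC₀⟩
    obtain ⟨j⟩ := ‹Nonempty L›
    refine ⟨C, hC, ?_⟩
    rw [hCa, ← ha _ (isPure_single j)]
    exact mul_le_mul_of_nonneg_right (Set.mem_iInter.1 hCK ⟨_, isPure_single j⟩) hd.le
  · rintro ⟨C₀, hC₀, h₀⟩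
    obtain ⟨C, hCK, hC, a, ha, hCa⟩ := hΦ.exists_isRecovery_const hch
      (K := {C | (1 - ε) * (Fintype.card L + 1) - 1 ≤ (C * choiState Φ).trace.re})
      (isClosed_le continuous_const (by fun_prop))
      (convex_halfSpace_ge hlinJ _)
      (by
        intro g C hC
        rwa [Set.mem_ofPred_eq, hΦ.trace_conj_mul_choiState])
      ⟨C₀, by rw [Set.mem_ofPred_eq]; linarith, hC₀⟩
    refine ⟨C, hC, fun ψ hψ => ?_⟩
    rw [ha ψ hψ]
    rw [Set.mem_ofPred_eq] at hCK
    exact le_of_mul_le_mul_right (by linarith) hd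

end Covariant

/-! ### Min-entropy of the Choi state and the equivalence -/

theorem IsCovariant.comp {G A B C : Type*} [Group G] [TopologicalSpace G] [Fintype A]
    [DecidableEq A] [Fintype B] [DecidableEq B] [Fintype C] [DecidableEq C]
    {u : G →ₜ* Matrix.unitaryGroup A ℂ} {v : G →ₜ* Matrix.unitaryGroup B ℂ}
    {w : G →ₜ* Matrix.unitaryGroup C ℂ} {Φ : Matrix A A ℂ →ₗ[ℂ] Matrix B B ℂ}
    {Ψ : Matrix B B ℂ →ₗ[ℂ] Matrix C C ℂ} (hΨ : IsCovariant v w Ψ) (hΦ : IsCovariant u v Φ) :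
    IsCovariant u w (Ψ ∘ₗ Φ) := fun g => by
  rw [LinearMap.comp_assoc, hΦ g, ← LinearMap.comp_assoc, hΨ g, LinearMap.comp_assoc]

section

variable {A B : Type*} [Fintype A] [DecidableEq A] [Fintype B]

theorem IsChannel.posSemidef_choiState {Φ : Matrix A A ℂ →ₗ[ℂ] Matrix B B ℂ}
    (hΦ : IsChannel Φ) : (choiState Φ).PosSemidef := by
  rw [choiState_eq]
  refine hΦ.posSemidef_choiMatrix.smul ?_
  rw [← Complex.ofReal_natCast, ← Complex.ofReal_inv]
  exact_mod_cast inv_nonneg.2 (Nat.cast_nonneg _)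

theorem IsChannel.trace_choiState [Nonempty A] {Φ : Matrix A A ℂ →ₗ[ℂ] Matrix B B ℂ}
    (hΦ : IsChannel Φ) : (choiState Φ).trace = 1 := by
  have h (k : A) : ∑ b, Φ (single k k 1) b b = 1 := by
    have := hΦ.tracePreserving (single k k 1)
    rwa [trace_single_eq_same] at this
  rw [choiState_eq, trace_smul]
  simp only [trace, diag, choiMatrix, of_apply, Fintype.sum_prod_type, h]
  simp

theorem IsChannel.nonempty [Nonempty A] {Φ : Matrix A A ℂ →ₗ[ℂ] Matrix B B ℂ}
    (hΦ : IsChannel Φ) : Nonempty B := by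
  by_contra hB
  rw [not_nonempty_iff] at hB
  have h := hΦ.tracePreserving 1
  rw [trace_one, trace, Finset.univ_eq_empty, Finset.sum_empty] at h
  exact Nat.cast_ne_zero.2 Fintype.card_ne_zero h.symm

/-- The min-entropy of the Choi state is `-log₂` of the maximum of `tr (C J)` over recoveries. -/
theorem IsChannel.exists_condMinEntropy_eq [Nonempty A] [DecidableEq B]
    {Φ : Matrix A A ℂ →ₗ[ℂ] Matrix B B ℂ} (hΦ : IsChannel Φ) :
    ∃ m : ℝ, 0 < m ∧ condMinEntropy (choiState Φ) = -Real.logb 2 m ∧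
      (∃ C, IsRecovery C ∧ (C * choiState Φ).trace.re = m) ∧
      ∀ C, IsRecovery C → (C * choiState Φ).trace.re ≤ m := by
  have := hΦ.nonempty
  have h₁ := isRecovery_inv_card_smul_one (A := A) (B := B)
  obtain ⟨C, hC, hmax⟩ := (isCompact_isRecovery (A := A) (B := B)).exists_isMaxOn ⟨_, h₁⟩
    (f := fun C => (C * choiState Φ).trace.re) (by fun_prop)
  refine ⟨_, ?_, ?_, ⟨C, hC, rfl⟩, fun C' hC' => hmax hC'⟩
  -- The depolarizing recovery has value 1/|A|, so the maximum is positive.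
  · refine lt_of_lt_of_le ?_ (hmax h₁)
    simp only [smul_mul_assoc, one_mul, trace_smul, hΦ.trace_choiState]
    simp [Fintype.card_pos]
  · unfold condMinEntropy
    congr 2
    have hlt (t : ℝ) (ht : (C * choiState Φ).trace.re < t) :=
      exists_dual_feasible hΦ.posSemidef_choiState
        fun C' hC' => lt_of_le_of_lt (show _ ≤ _ from hmax hC') ht
    refine csInf_eq_of_forall_ge_of_forall_gt_exists_lt ?_ ?_ ?_
    · obtain ⟨X, h1, h2, -⟩ := hlt _ (lt_add_one _)
      exact ⟨_, X, h1, h2, rfl⟩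
    · rintro _ ⟨X, -, h2, rfl⟩
      exact trace_mul_le_of_dual_feasible hC h2
    · intro t ht
      obtain ⟨X, h1, h2, h3⟩ := hlt t ht
      exact ⟨_, ⟨X, h1, h2, rfl⟩, h3⟩

end

theorem isCorrectable_iff {L P P' : Type*} [Fintype L] [DecidableEq L] [Fintype P]
    [Fintype P'] [DecidableEq P'] {E : Matrix L L ℂ →ₗ[ℂ] Matrix P P ℂ}
    {N : Matrix P P ℂ →ₗ[ℂ] Matrix P' P' ℂ} (hch : IsChannel (N ∘ₗ E)) (ε : ℝ) :
    IsCorrectable E N ε ↔ ∃ C, IsRecovery C ∧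
      ∀ ψ, IsPure ψ → 1 - ε ≤ (recoveryForm (N ∘ₗ E) C ψ ψ).re := by
  constructor
  · rintro ⟨D, hD, h⟩
    obtain ⟨C, hC, rfl⟩ := hD.exists_isRecovery
    exact ⟨C, hC, fun ψ hψ => hC.fidelity_eq hch hψ ▸ h ψ hψ⟩
  · rintro ⟨C, hC, h⟩
    exact ⟨_, hC.isChannel, fun ψ hψ => (h ψ hψ).trans_eq (hC.fidelity_eq hch hψ).symm⟩

/-- For x ≤ 0 the right-hand bound is +∞ and x ≤ m holds because m > 0, so both regimes obey one
criterion. -/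
theorem neg_logb_le_neg_extLog_iff {m x : ℝ} (hm : 0 < m) :
    ((-Real.logb 2 m : ℝ) : EReal) ≤ -extLog x ↔ x ≤ m := by
  unfold extLog
  split_ifs with hx
  · rw [EReal.coe_neg, EReal.neg_le_neg_iff, EReal.coe_le_coe_iff,
      Real.logb_le_logb (by norm_num) hx hm]
  · simp only [EReal.neg_bot, le_top, true_iff]
    linarith

end CovariantCode

theorem theorem1 {L P P' : Type*} [Fintype L] [DecidableEq L] [Nonempty L]
    [Fintype P] [DecidableEq P] [Fintype P'] [DecidableEq P']
    (uP : Matrix.unitaryGroup L ℂ →ₜ* Matrix.unitaryGroup P ℂ)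
    (uP' : Matrix.unitaryGroup L ℂ →ₜ* Matrix.unitaryGroup P' ℂ)
    (E : Matrix L L ℂ →ₗ[ℂ] Matrix P P ℂ) (hE : CovariantCode.IsChannel E)
    (hEcov : CovariantCode.IsCovariant
      (ContinuousMonoidHom.id (Matrix.unitaryGroup L ℂ)) uP E)
    (N : Matrix P P ℂ →ₗ[ℂ] Matrix P' P' ℂ) (hN : CovariantCode.IsChannel N)
    (hNcov : CovariantCode.IsCovariant uP uP' N)
    (ε c : ℝ) (hc : c = ((Fintype.card L : ℝ) + 1) / (Fintype.card L : ℝ)) :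
    CovariantCode.IsCorrectable E N ε ↔
      (CovariantCode.condMinEntropy (CovariantCode.choiState (N ∘ₗ E)) : EReal) ≤
        -CovariantCode.extLog ((Fintype.card L : ℝ) * (1 - c * ε)) := by
  have hch := hN.comp hE
  obtain ⟨m, hm, hent, ⟨C₀, hC₀, hC₀m⟩, hmax⟩ := hch.exists_condMinEntropy_eq
  have hd : (Fintype.card L : ℝ) ≠ 0 := by simp
  -- The constant c is what makes the entropy threshold equal the twirling threshold: both are d -
  -- (d + 1)ε.
  have hthr : (Fintype.card L : ℝ) * (1 - c * ε) = (1 - ε) * (Fintype.card L + 1) - 1 := by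
    rw [hc]
    field_simp
    ring
  rw [CovariantCode.isCorrectable_iff hch, CovariantCode.exists_isRecovery_iff hch
    (hNcov.comp hEcov), hent, CovariantCode.neg_logb_le_neg_extLog_iff hm, hthr]
  constructor
  · rintro ⟨C, hC, h⟩
    linarith [hmax C hC]
  · intro h
    exact ⟨C₀, hC₀, by linarith⟩
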